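/- For $x\in\mathbb{R}$ let $\langle x\rangle$ denote the distance from $x$ to the closest integer, let $\mathbb{N}=\{1,2,3,\dots\}$, and for $A\subseteq\mathbb{N}$ let $\overline{d}(A)=\limsup_{N\to\infty}\frac{|A\cap[1,N]|}{N}$ be its upper density. Let $a\in(0,1)$, $b>0$ with $2a<b$, and let $\alpha>1$. Then for Lebesgue-almost every $y\in[0,1]$ the following holds: for every $A\subseteq\mathbb{N}$ with $\overline{d}(A)>0$ there are infinitely many $m\in\mathbb{N}$ with $$\langle \alpha^{m^b}y\rangle<m^{-a}$$ such that $\{n,n+m\}\subseteq A$ for infinitely many $n\in\mathbb{N}$. -/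

import Mathlib

/-- The distance from a real number to the closest integer. -/
noncomputable def distNearestInt (x : ℝ) : ℝ := |x - round x|

/-- The upper density `limsup_{N → ∞} |A ∩ [1, N]| / N` of a set of natural numbers. The quotients
lie in `[0, 1]`, so the real-valued `limsup` is the genuine one. -/
noncomputable def upperDensity (A : Set ℕ) : ℝ :=
  Filter.limsup (fun N : ℕ => ((A ∩ Set.Icc 1 N).ncard : ℝ) / (N : ℝ)) Filter.atTop

/-! Fix a large `n` and a step `L` of size about `n ^ κ`, and use only the differences `m = L * (i +
1)` with `i < n`. Sparsifying by `L` makes the multipliers `α ^ (m ^ b)` grow by factors of at least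
`8 * (L * n) ^ a`. The inequality for `m` can therefore be forced by prescribing one digit of `y` in
base `q`, a power of two comparable to `(L * n) ^ a`, and distinct `m` use disjoint blocks of binary
digits. These events are exactly independent, of probability `1 / q` (`integral_prod_digitEvent`).

A Chernoff bound and a union bound over `2 * n + 1` frequencies show that, for most `y`, the cosine
sums of the centred indicators are not very negative. Since the difference counts of a finite set
have a nonnegative Fourier transform, every dense subset of `{0, …, n - 1}` then has a difference `i
+ 1` whose event holds (`exists_difference_of_cosine_sums`). The exceptional measure tends to zero
because `(L * n) ^ a` is at most `2 * n ^ σ` with `σ < 1`.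

Finally, a set of positive upper density is dense on progressions of step `L` and length `n`
starting arbitrarily far out (`exists_progression_of_upperDensity_pos`); pigeonhole over the `n`
candidates makes one `m` recur. -/

open MeasureTheory Set Filter Topology

/-! ### Adic digit events and their independence -/

/-- The event that the `q`-adic digit of `y` following its `M`-adic cell `j` equals `c j`. -/
def digitEvent (M q : ℕ) (c : ℕ → ℕ) : Set ℝ :=
  {y | ⌊(M * q : ℝ) * y⌋₊ = q * ⌊(M : ℝ) * y⌋₊ + c ⌊(M : ℝ) * y⌋₊}

theorem Ico_zero_one_eq_biUnion {M : ℕ} (hM : 0 < M) :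
    Ico (0 : ℝ) 1 = ⋃ j ∈ Finset.range M, Ico ((j : ℝ) / M) ((j + 1) / M) := by
  have hM' : (0 : ℝ) < M := by exact_mod_cast hM
  ext y
  simp only [mem_Ico, mem_iUnion, Finset.mem_range, exists_prop]
  constructor
  · rintro ⟨h0, h1⟩
    have h2 : 0 ≤ (M : ℝ) * y := by positivity
    refine ⟨⌊(M : ℝ) * y⌋₊, ?_, ?_, ?_⟩
    · rw [Nat.floor_lt h2]; nlinarith
    · rw [div_le_iff₀' hM']; exact Nat.floor_le h2
    · rw [lt_div_iff₀' hM']; exact Nat.lt_floor_add_one _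
  · rintro ⟨j, hj, h0, h1⟩
    refine ⟨le_trans (by positivity) h0, h1.trans_le ?_⟩
    rw [div_le_one hM']
    exact_mod_cast hj

theorem floor_mul_eq_of_mem_Ico {M j : ℕ} (hM : 0 < M) {y : ℝ}
    (hy : y ∈ Ico ((j : ℝ) / M) ((j + 1) / M)) : ⌊(M : ℝ) * y⌋₊ = j := by
  have hM' : (0 : ℝ) < M := by exact_mod_cast hM
  have h1 := (div_le_iff₀ hM').1 hy.1
  have h2 := (lt_div_iff₀ hM').1 hy.2
  have h0 : (0 : ℝ) ≤ j := by positivity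
  rw [Nat.floor_eq_iff (by linarith)]
  constructor <;> linarith

theorem integrableOn_floor_mul {M : ℕ} (hM : 0 < M) (g : ℕ → ℝ) :
    IntegrableOn (fun y : ℝ => g ⌊(M : ℝ) * y⌋₊) (Ico 0 1) := by
  rw [Ico_zero_one_eq_biUnion hM, integrableOn_finset_iUnion]
  intro j _
  have : IntegrableOn (fun _ : ℝ => g j) (Ico ((j : ℝ) / M) ((j + 1) / M)) :=
    integrableOn_const (by simp)
  exact this.congr_fun (fun y hy => by simp only [floor_mul_eq_of_mem_Ico hM hy]) measurableSet_Ico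

theorem integral_floor_mul {M : ℕ} (hM : 0 < M) (g : ℕ → ℝ) :
    ∫ y in Ico (0 : ℝ) 1, g ⌊(M : ℝ) * y⌋₊ = (∑ j ∈ Finset.range M, g j) / M := by
  have hM' : (0 : ℝ) < M := by exact_mod_cast hM
  have hint := integrableOn_floor_mul hM g
  rw [Ico_zero_one_eq_biUnion hM] at hint ⊢
  rw [integrableOn_finset_iUnion] at hint
  rw [integral_biUnion_finset _ (fun _ _ => measurableSet_Ico) ?_ hint, Finset.sum_div]
  · refine Finset.sum_congr rfl fun j _ => ?_
    rw [setIntegral_congr_fun (g := fun _ => g j) measurableSet_Ico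
      (fun y hy => by simp only [floor_mul_eq_of_mem_Ico hM hy])]
    rw [setIntegral_const, measureReal_def, Real.volume_Ico, ENNReal.toReal_ofReal, smul_eq_mul]
    · field_simp; ring
    · rw [← sub_div]; ring_nf; positivity
  · intro i _ j _ hij
    rw [Function.onFun, Set.disjoint_left]
    intro y hi hj
    exact hij ((floor_mul_eq_of_mem_Ico hM hi).symm.trans (floor_mul_eq_of_mem_Ico hM hj))

theorem floor_mul_eq_floor_mul_div {M K : ℕ} (hK : 0 < K) (h : M ∣ K) (y : ℝ) :
    ⌊(M : ℝ) * y⌋₊ = ⌊(K : ℝ) * y⌋₊ / (K / M) := by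
  obtain ⟨d, rfl⟩ := h
  have hM : 0 < M := Nat.pos_of_mul_pos_right hK
  have hd : 0 < d := Nat.pos_of_mul_pos_left hK
  rw [Nat.mul_div_cancel_left _ hM, ← Nat.floor_div_natCast]
  congr 1
  push_cast
  field_simp

theorem sum_range_mul_eq (M q : ℕ) (h : ℕ → ℝ) :
    ∑ x ∈ Finset.range (M * q), h x =
      ∑ j ∈ Finset.range M, ∑ t ∈ Finset.range q, h (q * j + t) := by
  induction M with
  | zero => simp
  | succ M ih => rw [Nat.succ_mul, Finset.sum_range_add, ih, Finset.sum_range_succ, mul_comm q M]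

open Classical in
-- Each `M`-adic cell splits into `q` equal subcells, exactly one of which lies in the event, so
-- conditioning on the cell leaves probability `1 / q`.
theorem integral_mul_digitEvent {M q : ℕ} (hM : 0 < M) (hq : 0 < q) {c : ℕ → ℕ}
    (hc : ∀ j, c j < q) (g : ℕ → ℝ) (u v : ℝ) :
    ∫ y in Ico (0 : ℝ) 1, g ⌊(M : ℝ) * y⌋₊ * (if y ∈ digitEvent M q c then u else v) =
      (∫ y in Ico (0 : ℝ) 1, g ⌊(M : ℝ) * y⌋₊) * ((u + (q - 1) * v) / q) := by
  have hq' : (0 : ℝ) < q := by exact_mod_cast hq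
  have hM' : (0 : ℝ) < M := by exact_mod_cast hM
  have key : ∀ y : ℝ, g ⌊(M : ℝ) * y⌋₊ * (if y ∈ digitEvent M q c then u else v) =
      (fun x : ℕ => g (x / q) * (if x = q * (x / q) + c (x / q) then u else v))
        ⌊((M * q : ℕ) : ℝ) * y⌋₊ := by
    intro y
    have h1 := floor_mul_eq_floor_mul_div (Nat.mul_pos hM hq) (dvd_mul_right M q) y
    rw [Nat.mul_div_cancel_left _ hM] at h1
    simp only [digitEvent, mem_ofPred_eq, ← h1]
    push_cast
    congr
  rw [integral_congr_ae (ae_of_all _ key), integral_floor_mul (Nat.mul_pos hM hq)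
    (fun x : ℕ => g (x / q) * (if x = q * (x / q) + c (x / q) then u else v)), integral_floor_mul hM, sum_range_mul_eq]
  have inner : ∀ j, ∑ t ∈ Finset.range q, (fun x : ℕ => g (x / q) *
      (if x = q * (x / q) + c (x / q) then u else v)) (q * j + t) = g j * (u + (q - 1) * v) := by
    intro j
    have : ∀ t ∈ Finset.range q, (fun x : ℕ => g (x / q) *
        (if x = q * (x / q) + c (x / q) then u else v)) (q * j + t) =
        g j * (v + if t = c j then u - v else 0) := by
      intro t ht
      have ht' := Finset.mem_range.1 ht
      have hd : (q * j + t) / q = j := by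
        rw [Nat.mul_add_div hq, Nat.div_eq_of_lt ht', add_zero]
      simp only [hd, add_right_inj]
      split_ifs <;> ring
    rw [Finset.sum_congr rfl this, ← Finset.mul_sum, Finset.sum_add_distrib, Finset.sum_ite_eq',
      if_pos (Finset.mem_range.2 (hc j))]
    simp
    ring_nf
    simp
  simp_rw [inner]
  rw [← Finset.sum_mul]
  push_cast
  field_simp

open Classical in
theorem exists_prod_digitEvent_eq {n q K : ℕ} (hK : 0 < K) {M : ℕ → ℕ} (c : ℕ → ℕ → ℕ)
    (hdvd : ∀ i < n, M i * q ∣ K) (u v : ℕ → ℝ) :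
    ∃ g : ℕ → ℝ, ∀ y, ∏ i ∈ Finset.range n,
      (if y ∈ digitEvent (M i) q (c i) then u i else v i) = g ⌊(K : ℝ) * y⌋₊ := by
  refine ⟨fun x => ∏ i ∈ Finset.range n, (if x / (K / (M i * q)) =
    q * (x / (K / M i)) + c i (x / (K / M i)) then u i else v i), fun y => ?_⟩
  refine Finset.prod_congr rfl fun i hi => ?_
  have h1 := hdvd i (Finset.mem_range.1 hi)
  have h2 := floor_mul_eq_floor_mul_div hK h1 y
  have h3 := floor_mul_eq_floor_mul_div hK ((dvd_mul_right _ _).trans h1) y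
  simp only [digitEvent, mem_ofPred_eq, ← h2, ← h3]
  push_cast
  congr

open Classical in
-- Independence: by divisibility all earlier factors are constant on the cells of the last modulus,
-- so the last factor splits off.
theorem integral_prod_digitEvent {n q : ℕ} (hq : 0 < q) {M : ℕ → ℕ} (hM : ∀ i, 0 < M i)
    {c : ℕ → ℕ → ℕ} (hc : ∀ i j, c i j < q)
    (hdvd : ∀ i j, i < j → j < n → M i * q ∣ M j) (u v : ℕ → ℝ) :
    ∫ y in Ico (0 : ℝ) 1, ∏ i ∈ Finset.range n,
      (if y ∈ digitEvent (M i) q (c i) then u i else v i) =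
      ∏ i ∈ Finset.range n, ((u i + (q - 1) * v i) / q) := by
  induction n with
  | zero => simp
  | succ n ih =>
    obtain ⟨g, hg⟩ := exists_prod_digitEvent_eq (hM n) c
      (fun i hi => hdvd i n hi (Nat.lt_succ_self n)) u v
    rw [Finset.prod_range_succ, ← ih fun i j hij hj => hdvd i j hij (hj.trans n.lt_succ_self)]
    simp_rw [Finset.prod_range_succ, hg]
    exact integral_mul_digitEvent (hM n) hq (hc n) g _ _

/-! ### Fourier analysis of difference counts -/

theorem sum_cos_two_pi_mul_div {Q : ℕ} {z : ℤ} (hz : |z| < Q) :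
    ∑ j ∈ Finset.range Q, Real.cos (2 * Real.pi * j * z / Q) = if z = 0 then (Q : ℝ) else 0 := by
  split_ifs with h
  · simp [h]
  have hQ : Q ≠ 0 := by rintro rfl; simp at hz; linarith [abs_nonneg z]
  have hprim := Complex.isPrimitiveRoot_exp Q hQ
  set ζ : ℂ := Complex.exp (2 * Real.pi * Complex.I / Q) with hζ
  have hne : ζ ^ z ≠ 1 := by
    intro h1
    rw [hprim.zpow_eq_one_iff_dvd] at h1
    exact h (Int.eq_zero_of_abs_lt_dvd h1 hz)
  have hpow : (ζ ^ z) ^ Q = 1 := by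
    rw [← zpow_natCast, ← zpow_mul, mul_comm, zpow_mul, zpow_natCast, hprim.pow_eq_one, one_zpow]
  have hsum : ∑ j ∈ Finset.range Q, (ζ ^ z) ^ j = 0 := by
    have := mul_geom_sum (ζ ^ z) Q
    rw [hpow, sub_self] at this
    exact (mul_eq_zero.1 this).resolve_left (sub_ne_zero.2 hne)
  have hre := congrArg Complex.re hsum
  rw [Complex.re_sum, Complex.zero_re] at hre
  rw [← hre]
  refine Finset.sum_congr rfl fun j _ => ?_
  rw [hζ, ← Complex.exp_int_mul, ← Complex.exp_nat_mul, ← Complex.exp_ofReal_mul_I_re]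
  congr 2
  push_cast
  ring

/-- The modulus `2 * n + 1` exceeds `|x - x' ± m|`, so a congruence between these differences is an
equality and nothing wraps around. -/
theorem sum_cos_mul_cos {n m x x' : ℕ} (hm : m ≤ n) (hx : x < n) (hx' : x' < n) :
    ∑ j ∈ Finset.range (2 * n + 1), Real.cos (2 * Real.pi * j * (x - x') / (2 * n + 1 : ℕ)) *
        Real.cos (2 * Real.pi * j * m / (2 * n + 1 : ℕ)) =
      (2 * n + 1 : ℕ) / 2 * ((if x' = x + m then 1 else 0) + (if x = x' + m then 1 else 0)) := by
  have h1 := sum_cos_two_pi_mul_div (Q := 2 * n + 1) (z := (x : ℤ) - x' + m)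
    (by rw [abs_lt]; constructor <;> push_cast <;> omega)
  have h2 := sum_cos_two_pi_mul_div (Q := 2 * n + 1) (z := (x : ℤ) - x' - m)
    (by rw [abs_lt]; constructor <;> push_cast <;> omega)
  have e1 : ((x : ℤ) - x' + m = 0) ↔ x' = x + m := by omega
  have e2 : ((x : ℤ) - x' - m = 0) ↔ x = x' + m := by omega
  simp only [e1] at h1
  simp only [e2] at h2
  have : ∀ j ∈ Finset.range (2 * n + 1),
      Real.cos (2 * Real.pi * j * (x - x') / (2 * n + 1 : ℕ)) *
        Real.cos (2 * Real.pi * j * m / (2 * n + 1 : ℕ)) =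
      1 / 2 * (Real.cos (2 * Real.pi * j * ((x : ℤ) - x' + m : ℤ) / (2 * n + 1 : ℕ)) +
        Real.cos (2 * Real.pi * j * ((x : ℤ) - x' - m : ℤ) / (2 * n + 1 : ℕ))) := by
    intro j _
    have a1 : 2 * Real.pi * j * (((x : ℤ) - x' + m : ℤ) : ℝ) / (2 * n + 1 : ℕ) =
      2 * Real.pi * j * (x - x') / (2 * n + 1 : ℕ) + 2 * Real.pi * j * m / (2 * n + 1 : ℕ) := by
      push_cast; ring
    have a2 : 2 * Real.pi * j * (((x : ℤ) - x' - m : ℤ) : ℝ) / (2 * n + 1 : ℕ) =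
      2 * Real.pi * j * (x - x') / (2 * n + 1 : ℕ) - 2 * Real.pi * j * m / (2 * n + 1 : ℕ) := by
      push_cast; ring
    rw [a1, a2, Real.cos_add, Real.cos_sub]
    ring
  rw [Finset.sum_congr rfl this, ← Finset.mul_sum, Finset.sum_add_distrib, h1, h2]
  split_ifs <;> ring

/-- The number of pairs in `A` with difference `m`. -/
def differenceCount (A : Finset ℕ) (m : ℕ) : ℕ := (A.filter fun x => x + m ∈ A).card

theorem differenceCount_eq_sum (A : Finset ℕ) (m : ℕ) :
    (differenceCount A m : ℝ) = ∑ x ∈ A, ∑ x' ∈ A, if x' = x + m then 1 else 0 := by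
  simp [differenceCount, Finset.sum_ite_eq']

theorem sum_differenceCount {n : ℕ} {A : Finset ℕ} (hA : A ⊆ Finset.range n) :
    2 * ∑ i ∈ Finset.range n, (differenceCount A (i + 1) : ℝ) = A.card * (A.card - 1) := by
  have h1 : ∑ i ∈ Finset.range n, (differenceCount A (i + 1) : ℝ) =
      ∑ x ∈ A, ∑ x' ∈ A, if x < x' then 1 else 0 := by
    simp_rw [differenceCount_eq_sum]
    rw [Finset.sum_comm]
    refine Finset.sum_congr rfl fun x hx => ?_
    rw [Finset.sum_comm]
    refine Finset.sum_congr rfl fun x' hx' => ?_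
    have := Finset.mem_range.1 (hA hx')
    split_ifs with h
    · rw [Finset.sum_eq_single (x' - x - 1)]
      · rw [if_pos (by omega)]
      · intro i _ hi; rw [if_neg (by omega)]
      · intro hi; exact absurd (Finset.mem_range.2 (by omega)) hi
    · exact Finset.sum_eq_zero fun i _ => if_neg (by omega)
  have h2 : ∑ x ∈ A, ∑ x' ∈ A, (if x < x' then (1 : ℝ) else 0) =
      ∑ x ∈ A, ∑ x' ∈ A, if x' < x then 1 else 0 := Finset.sum_comm
  rw [two_mul, h1]
  nth_rw 2 [h2]
  rw [← Finset.sum_add_distrib]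
  simp_rw [← Finset.sum_add_distrib]
  have : ∀ x ∈ A, ∑ x' ∈ A, ((if x < x' then (1 : ℝ) else 0) + if x' < x then 1 else 0) =
      A.card - 1 := by
    intro x hx
    have : ∀ x' ∈ A, ((if x < x' then (1 : ℝ) else 0) + if x' < x then 1 else 0) =
        1 - if x = x' then 1 else 0 := by
      intro x' _
      rcases lt_trichotomy x x' with h | h | h
      · simp [h, h.ne, h.le]
      · simp [h]
      · simp [h, h.ne', h.le]
    rw [Finset.sum_congr rfl this, Finset.sum_sub_distrib, Finset.sum_ite_eq, if_pos hx]
    simp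
  rw [Finset.sum_congr rfl this, Finset.sum_const, nsmul_eq_mul]

/-- The power spectrum `F j` of the indicator of `A` is nonnegative and has total mass `Q * A.card`.
Weighting the lower bound on the cosine sums by `F` and inverting the transform gives the claim. -/
theorem sum_mul_differenceCount_ge {n : ℕ} {A : Finset ℕ} (hA : A ⊆ Finset.range n) (w : ℕ → ℝ)
    {τ : ℝ} (hw : ∀ j < 2 * n + 1, -τ ≤ ∑ i ∈ Finset.range n,
      w i * Real.cos (2 * Real.pi * j * (i + 1 : ℕ) / (2 * n + 1 : ℕ))) :
    -τ * A.card ≤ ∑ i ∈ Finset.range n, w i * differenceCount A (i + 1) := by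
  set Q : ℝ := ((2 * n + 1 : ℕ) : ℝ) with hQ
  have hQpos : 0 < Q := by rw [hQ]; positivity
  set F : ℕ → ℝ := fun j => ∑ x ∈ A, ∑ x' ∈ A, Real.cos (2 * Real.pi * j * (x - x') / Q) with hF
  have hFnn : ∀ j, 0 ≤ F j := by
    intro j
    have : F j = (∑ x ∈ A, Real.cos (2 * Real.pi * j * x / Q)) ^ 2 +
        (∑ x ∈ A, Real.sin (2 * Real.pi * j * x / Q)) ^ 2 := by
      simp only [hF, sq, Finset.sum_mul_sum, ← Finset.sum_add_distrib]
      refine Finset.sum_congr rfl fun x _ => Finset.sum_congr rfl fun x' _ => ?_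
      rw [mul_sub, sub_div, Real.cos_sub]
    rw [this]; positivity
  have key : ∀ m ≤ n, ∑ j ∈ Finset.range (2 * n + 1), F j * Real.cos (2 * Real.pi * j * m / Q) =
      Q * differenceCount A m := by
    intro m hm
    simp only [hF, Finset.sum_mul]
    rw [Finset.sum_comm]
    simp_rw [Finset.sum_comm (s := Finset.range (2 * n + 1))]
    have : ∀ x ∈ A, ∀ x' ∈ A, ∑ j ∈ Finset.range (2 * n + 1),
        Real.cos (2 * Real.pi * j * (x - x') / Q) * Real.cos (2 * Real.pi * j * m / Q) =
        Q / 2 * ((if x' = x + m then 1 else 0) + (if x = x' + m then 1 else 0)) :=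
      fun x hx x' hx' =>
        sum_cos_mul_cos hm (Finset.mem_range.1 (hA hx)) (Finset.mem_range.1 (hA hx'))
    rw [Finset.sum_congr rfl fun x hx => Finset.sum_congr rfl (this x hx)]
    simp_rw [← Finset.mul_sum, Finset.sum_add_distrib]
    rw [Finset.sum_comm (f := fun x x' : ℕ => if x = x' + m then (1 : ℝ) else 0),
      ← differenceCount_eq_sum]
    ring
  have key0 : ∑ j ∈ Finset.range (2 * n + 1), F j = Q * A.card := by
    have h0 := key 0 (Nat.zero_le n)
    simpa [differenceCount] using h0
  have h1 : ∑ j ∈ Finset.range (2 * n + 1), F j * (-τ) ≤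
      ∑ j ∈ Finset.range (2 * n + 1), F j * ∑ i ∈ Finset.range n,
        w i * Real.cos (2 * Real.pi * j * (i + 1 : ℕ) / Q) :=
    Finset.sum_le_sum fun j hj =>
      mul_le_mul_of_nonneg_left (hw j (Finset.mem_range.1 hj)) (hFnn j)
  rw [← Finset.sum_mul, key0] at h1
  have h2 : ∑ j ∈ Finset.range (2 * n + 1), F j * ∑ i ∈ Finset.range n,
        w i * Real.cos (2 * Real.pi * j * (i + 1 : ℕ) / Q) =
      Q * ∑ i ∈ Finset.range n, w i * differenceCount A (i + 1) := by
    simp_rw [Finset.mul_sum]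
    rw [Finset.sum_comm]
    refine Finset.sum_congr rfl fun i hi => ?_
    have := key (i + 1) (Finset.mem_range.1 hi)
    calc _ = w i * ∑ j ∈ Finset.range (2 * n + 1),
          F j * Real.cos (2 * Real.pi * j * (i + 1 : ℕ) / Q) := by
            rw [Finset.mul_sum]; exact Finset.sum_congr rfl fun j _ => by ring
      _ = _ := by rw [this]; ring
  rw [h2] at h1
  have h3 : Q * (-τ * A.card) ≤ Q * ∑ i ∈ Finset.range n, w i * differenceCount A (i + 1) := by
    linarith
  exact le_of_mul_le_mul_left h3 hQpos

open Classical in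
theorem exists_difference_of_cosine_sums {n : ℕ} {A : Finset ℕ} (hA : A ⊆ Finset.range n)
    {p ε : ℝ} (hp : 0 < p) (hcard : 2 * ε * n + 1 < A.card) (hne : 0 ≤ ε) (E : ℕ → Prop)
    (hE : ∀ j < 2 * n + 1, -(ε * p * n) ≤ ∑ i ∈ Finset.range n,
      ((if E i then 1 else 0) - p) *
        Real.cos (2 * Real.pi * j * (i + 1 : ℕ) / (2 * n + 1 : ℕ))) :
    ∃ i < n, E i ∧ ∃ x ∈ A, x + (i + 1) ∈ A := by
  have h1 := sum_mul_differenceCount_ge hA _ hE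
  simp_rw [sub_mul] at h1
  rw [Finset.sum_sub_distrib, ← Finset.mul_sum] at h1
  have h2 := sum_differenceCount hA
  have hpos : 0 < (A.card : ℝ) := by
    have : 0 ≤ 2 * ε * n := by positivity
    linarith
  have h3 : 0 < ∑ i ∈ Finset.range n, (if E i then 1 else 0) * (differenceCount A (i + 1) : ℝ) := by
    -- Twice the main term `p * ∑ differenceCount`, minus twice the Fourier error `ε * p * n *
    -- A.card`.
    have : 0 < p * A.card * (A.card - 1 - 2 * ε * n) := by
      apply mul_pos (by positivity); linarith
    nlinarith
  obtain ⟨i, hi, hi'⟩ := Finset.exists_ne_zero_of_sum_ne_zero h3.ne'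
  refine ⟨i, Finset.mem_range.1 hi, ?_⟩
  by_cases hEi : E i
  · refine ⟨hEi, ?_⟩
    rw [if_pos hEi, one_mul, Nat.cast_ne_zero, differenceCount, Finset.card_ne_zero] at hi'
    obtain ⟨x, hx⟩ := hi'
    exact ⟨x, Finset.mem_filter.1 hx⟩
  · simp [hEi] at hi'

/-! ### From digits to distance to the nearest integer -/

theorem exists_digit_selection {M q : ℕ} (hM : 0 < M) (hq : 0 < q) {l δ : ℝ} (hMl : M ≤ l)
    (hlM : l < 2 * M) (hδ : 2 / δ ≤ q) (hδ0 : 0 < δ) :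
    ∃ c : ℕ → ℕ, (∀ j, c j < q) ∧ ∀ y : ℝ, 0 ≤ y →
      ⌊(M * q : ℝ) * y⌋₊ = q * ⌊(M : ℝ) * y⌋₊ + c ⌊(M : ℝ) * y⌋₊ → distNearestInt (l * y) < δ := by
  have hM' : (0 : ℝ) < M := by exact_mod_cast hM
  have hq' : (0 : ℝ) < q := by exact_mod_cast hq
  have hl : 0 < l := hM'.trans_le hMl
  have key : ∀ j : ℕ, ∃ d < q, ∀ y : ℝ, 0 ≤ y → ⌊(M * q : ℝ) * y⌋₊ = q * j + d →
      distNearestInt (l * y) < δ := by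
    intro j
    -- As `M ≤ l`, the cell `j` has length at least `1 / l` and contains a point `z` with `l * z` an
    -- integer. The chosen digit is that of the subcell containing `z`, whose width `1 / (M * q)`
    -- costs less than `2 / q` after multiplication by `l`.
    set N : ℤ := ⌈(j : ℝ) * l / M⌉
    have hN1 : (j : ℝ) * l / M ≤ N := Int.le_ceil _
    have hN2 : (N : ℝ) < j * l / M + 1 := Int.ceil_lt_add_one _
    set z : ℝ := N / l with hz
    have hzl : l * z = N := by rw [hz]; field_simp
    have hz1 : (j : ℝ) ≤ M * z := by
      rw [hz, ← mul_div_assoc, le_div_iff₀ hl]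
      rw [div_le_iff₀ hM'] at hN1; linarith
    have hz2 : M * z < j + 1 := by
      rw [hz, ← mul_div_assoc, div_lt_iff₀ hl]
      have : (N : ℝ) * M < j * l + M := by
        have := mul_lt_mul_of_pos_right hN2 hM'
        rwa [add_mul, div_mul_cancel₀ _ hM'.ne', one_mul] at this
      linarith
    have hz0 : 0 ≤ (M * q : ℝ) * z := by
      have : (0 : ℝ) ≤ j := by positivity
      nlinarith
    have hf1 : q * j ≤ ⌊(M * q : ℝ) * z⌋₊ := by
      apply Nat.le_floor; push_cast; nlinarith
    have hf2 : ⌊(M * q : ℝ) * z⌋₊ < q * j + q := by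
      rw [Nat.floor_lt hz0]; push_cast; nlinarith
    refine ⟨⌊(M * q : ℝ) * z⌋₊ - q * j, by omega, fun y hy h => ?_⟩
    have h' : ⌊(M * q : ℝ) * y⌋₊ = ⌊(M * q : ℝ) * z⌋₊ := by omega
    have hy0 : 0 ≤ (M * q : ℝ) * y := by positivity
    have b1 := Nat.floor_le hy0
    have b2 := Nat.lt_floor_add_one ((M * q : ℝ) * y)
    have b3 := Nat.floor_le hz0
    have b4 := Nat.lt_floor_add_one ((M * q : ℝ) * z)
    rw [h'] at b1 b2
    have hd : |(M * q : ℝ) * (y - z)| < 1 := by rw [abs_lt]; constructor <;> nlinarith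
    have hd2 : |y - z| < 1 / (M * q) := by
      rw [abs_mul, abs_of_pos (by positivity : (0 : ℝ) < M * q)] at hd
      rw [lt_div_iff₀ (by positivity)]; linarith
    calc distNearestInt (l * y) ≤ |l * y - N| := round_le _ _
      _ = l * |y - z| := by rw [← hzl, ← mul_sub, abs_mul, abs_of_pos hl]
      _ < 2 * M * (1 / (M * q)) := by
        apply mul_lt_mul'' hlM hd2 hl.le (abs_nonneg _)
      _ = 2 / q := by field_simp
      _ ≤ δ := by
        rw [div_le_iff₀ hδ0] at hδ
        rw [div_le_iff₀ hq']; linarith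
  choose c hc hc' using key
  exact ⟨c, hc, fun y hy h => hc' _ y hy h⟩

/-! ### Progressions in sets of positive upper density -/

open Classical in
-- If every late progression were sparse, averaging over its starting point would bound the upper
-- density by half of itself.
theorem exists_progression_of_upperDensity_pos {A : Set ℕ} (hA : 0 < upperDensity A) :
    ∃ δ : ℝ, 0 < δ ∧ ∀ n L : ℕ, 0 < n → ∀ B : ℕ, ∃ n₀ > B,
      δ * n ≤ ((Finset.range n).filter fun x => n₀ + L * x ∈ A).card := by
  refine ⟨upperDensity A / 2, by positivity, fun n L hn B => ?_⟩
  set δ := upperDensity A / 2 with hδ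
  by_contra! hcon
  have hδ0 : 0 < δ := by positivity
  have hn' : (0 : ℝ) < n := by exact_mod_cast hn
  -- Past `C`, each element of `A` up to `N` is hit by `n` progressions, one for each `x < n`, all
  -- starting in `(B, N]`.
  set C : ℕ := B + 1 + L * n
  have hcount : ∀ N : ℕ, ((A ∩ Icc 1 N).ncard : ℝ) ≤ C + δ * N := by
    intro N
    set S := (Finset.Icc C N).filter (· ∈ A) with hS
    have h1 : (A ∩ Icc 1 N).ncard ≤ C + S.card := by
      have hsub : A ∩ Icc 1 N ⊆ ((Finset.range C ∪ S : Finset ℕ) : Set ℕ) := by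
        rintro x ⟨hx, hx1, hx2⟩
        simp only [hS, Finset.coe_union, mem_union, Finset.mem_coe, Finset.mem_range,
          Finset.mem_filter, Finset.mem_Icc]
        by_cases h : x < C
        · exact Or.inl h
        · exact Or.inr ⟨⟨by omega, hx2⟩, hx⟩
      calc _ ≤ ((Finset.range C ∪ S : Finset ℕ) : Set ℕ).ncard :=
            Set.ncard_le_ncard hsub (Finset.finite_toSet _)
        _ ≤ _ := by
          rw [Set.ncard_coe_finset]
          exact (Finset.card_union_le _ _).trans (by simp)
    have h2 : n * S.card ≤ ∑ n₀ ∈ Finset.Ioc B N,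
        ((Finset.range n).filter fun x => n₀ + L * x ∈ A).card := by
      have e1 : n * S.card = ∑ x ∈ Finset.range n, S.card := by simp
      have e2 : ∑ n₀ ∈ Finset.Ioc B N,
          ((Finset.range n).filter fun x => n₀ + L * x ∈ A).card =
          ∑ x ∈ Finset.range n, ((Finset.Ioc B N).filter fun n₀ => n₀ + L * x ∈ A).card := by
        simp_rw [Finset.card_filter]
        exact Finset.sum_comm
      rw [e1, e2]
      refine Finset.sum_le_sum fun x hx => ?_
      refine Finset.card_le_card_of_injOn (fun z => z - L * x) ?_ ?_
      · intro z hz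
        have hLx : L * x ≤ L * n := Nat.mul_le_mul_left _ (Finset.mem_range.1 hx).le
        simp only [hS, Finset.coe_filter, Finset.mem_Icc, mem_ofPred_eq, Finset.mem_Ioc] at hz ⊢
        have : z - L * x + L * x = z := by omega
        refine ⟨by omega, ?_⟩
        rw [this]; exact hz.2
      · intro z hz z' hz' hzz
        have hLx : L * x ≤ L * n := Nat.mul_le_mul_left _ (Finset.mem_range.1 hx).le
        simp only [hS, Finset.coe_filter, Finset.mem_Icc, mem_ofPred_eq] at hz hz' hzz
        omega
    have h3 : (∑ n₀ ∈ Finset.Ioc B N,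
        ((Finset.range n).filter fun x => n₀ + L * x ∈ A).card : ℝ) ≤ N * (δ * n) := by
      calc _ ≤ ∑ n₀ ∈ Finset.Ioc B N, δ * n :=
            Finset.sum_le_sum fun n₀ h => (hcon n₀ (Finset.mem_Ioc.1 h).1).le
        _ = ((N - B : ℕ) : ℝ) * (δ * n) := by simp
        _ ≤ _ := by gcongr; omega
    have h4 : (n : ℝ) * S.card ≤ n * (δ * N) := by
      calc (n : ℝ) * S.card = ((n * S.card : ℕ) : ℝ) := by push_cast; ring
        _ ≤ _ := (Nat.cast_le.2 h2)
        _ ≤ N * (δ * n) := by push_cast; exact h3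
        _ = _ := by ring
    have h5 := le_of_mul_le_mul_left h4 hn'
    calc _ ≤ ((C + S.card : ℕ) : ℝ) := by exact_mod_cast h1
      _ ≤ _ := by push_cast; linarith
  have hlim : Tendsto (fun N : ℕ => (C : ℝ) / N + δ) atTop (𝓝 δ) := by
    simpa using (tendsto_const_div_atTop_nhds_zero_nat (C : ℝ)).add_const δ
  have hle : upperDensity A ≤ δ := by
    rw [← hlim.limsup_eq]
    refine limsup_le_limsup ?_ ?_ hlim.isBoundedUnder_le
    · filter_upwards [eventually_gt_atTop 0] with N hN
      have hN' : (0 : ℝ) < N := by exact_mod_cast hN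
      rw [div_le_iff₀ hN', add_mul, div_mul_cancel₀ _ hN'.ne']
      exact hcount N
    · exact (isBoundedUnder_of ⟨0, fun N => by positivity⟩ : IsBoundedUnder (· ≥ ·) _ _).isCoboundedUnder_le
  linarith

/-! ### Chernoff bound for digit sums -/

/-- Apply `exp t ≤ 1 + t + t ^ 2`: centring cancels the linear terms, and the variance is at most
`p`. -/
theorem bernoulli_exp_moment_le {p s b : ℝ} (hp0 : 0 ≤ p) (hp1 : p ≤ 1) (hs : |s| ≤ 1)
    (hb : |b| ≤ 1) :
    p * Real.exp (s * ((1 - p) * b)) + (1 - p) * Real.exp (s * ((0 - p) * b)) ≤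
      Real.exp (s ^ 2 * p) := by
  have hsb : |s * b| ≤ 1 := by
    rw [abs_mul]; exact mul_le_one₀ hs (abs_nonneg _) hb
  have bound : ∀ t : ℝ, |t| ≤ 1 → Real.exp t ≤ 1 + t + t ^ 2 := fun t ht => by
    have := (abs_le.1 (Real.abs_exp_sub_one_sub_id_le ht)).2
    linarith
  have h1 := bound (s * ((1 - p) * b)) (by
    have : s * ((1 - p) * b) = (1 - p) * (s * b) := by ring
    rw [this, abs_mul, abs_of_nonneg (by linarith : 0 ≤ 1 - p)]
    exact mul_le_one₀ (by linarith) (abs_nonneg _) hsb)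
  have h2 := bound (s * ((0 - p) * b)) (by
    have : s * ((0 - p) * b) = -(p * (s * b)) := by ring
    rw [this, abs_neg, abs_mul, abs_of_nonneg hp0]
    exact mul_le_one₀ hp1 (abs_nonneg _) hsb)
  have h3 := Real.add_one_le_exp (s ^ 2 * p)
  have hb2 : b ^ 2 ≤ 1 := (sq_le_one_iff_abs_le_one b).2 hb
  have h4 : s ^ 2 * b ^ 2 * (p * (1 - p)) ≤ s ^ 2 * p := by
    have e1 : s ^ 2 * b ^ 2 ≤ s ^ 2 := mul_le_of_le_one_right (sq_nonneg s) hb2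
    have e2 : p * (1 - p) ≤ p := mul_le_of_le_one_right hp0 (by linarith)
    exact mul_le_mul e1 e2 (mul_nonneg hp0 (by linarith)) (sq_nonneg s)
  have h5 := mul_le_mul_of_nonneg_left h1 hp0
  have h6 := mul_le_mul_of_nonneg_left h2 (by linarith : 0 ≤ 1 - p)
  nlinarith

open Classical in
theorem measure_digitEvent_sum_le {n q : ℕ} (hq : 0 < q) {M : ℕ → ℕ} (hM : ∀ i, 0 < M i)
    {c : ℕ → ℕ → ℕ} (hc : ∀ i j, c i j < q)
    (hdvd : ∀ i j, i < j → j < n → M i * q ∣ M j) {b : ℕ → ℝ} (hb : ∀ i, |b i| ≤ 1)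
    {ε : ℝ} (hε0 : 0 ≤ ε) (hε1 : ε ≤ 1) :
    (volume.restrict (Ico (0 : ℝ) 1)).real {y | ∑ i ∈ Finset.range n,
        ((if y ∈ digitEvent (M i) q (c i) then 1 else 0) - (1 / q : ℝ)) * b i ≤
        -(ε * (1 / q) * n)} ≤ Real.exp (-(ε ^ 2 * n / (4 * q))) := by
  have hq' : (1 : ℝ) ≤ q := by exact_mod_cast hq
  set p : ℝ := 1 / q with hp
  have hp0 : 0 ≤ p := by positivity
  have hp1 : p ≤ 1 := by rw [hp, div_le_one (by linarith)]; exact hq'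
  set X : ℝ → ℝ := fun y => ∑ i ∈ Finset.range n,
    ((if y ∈ digitEvent (M i) q (c i) then 1 else 0) - p) * b i with hX
  -- This `t` minimises the resulting exponent `t * ε * p * n + n * t ^ 2 * p`, with value `-(ε ^ 2
  -- * p * n / 4)`.
  set t : ℝ := -(ε / 2) with ht
  have hexp : ∀ y, Real.exp (t * X y) = ∏ i ∈ Finset.range n,
      (if y ∈ digitEvent (M i) q (c i) then Real.exp (t * ((1 - p) * b i))
        else Real.exp (t * ((0 - p) * b i))) := by
    intro y
    rw [hX, Finset.mul_sum, Real.exp_sum]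
    refine Finset.prod_congr rfl fun i _ => ?_
    split_ifs <;> rfl
  have hint : Integrable (fun y => Real.exp (t * X y)) (volume.restrict (Ico (0 : ℝ) 1)) := by
    have hK : 0 < ∏ i ∈ Finset.range n, M i * q :=
      Finset.prod_pos fun i _ => Nat.mul_pos (hM i) hq
    obtain ⟨g, hg⟩ := exists_prod_digitEvent_eq hK c
      (fun i hi => Finset.dvd_prod_of_mem _ (Finset.mem_range.2 hi))
      (fun i => Real.exp (t * ((1 - p) * b i))) (fun i => Real.exp (t * ((0 - p) * b i)))
    simp_rw [hexp, hg]
    exact integrableOn_floor_mul hK g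
  have h1 := ProbabilityTheory.measure_le_le_exp_mul_mgf (X := X) (-(ε * p * n))
    (by rw [ht]; linarith : t ≤ 0) hint
  refine h1.trans ?_
  have h2 : ProbabilityTheory.mgf X (volume.restrict (Ico (0 : ℝ) 1)) t ≤
      Real.exp (n * (t ^ 2 * p)) := by
    rw [ProbabilityTheory.mgf]
    simp_rw [hexp]
    rw [integral_prod_digitEvent hq hM hc hdvd, Real.exp_nat_mul]
    calc _ ≤ ∏ i ∈ Finset.range n, Real.exp (t ^ 2 * p) := by
          refine Finset.prod_le_prod (fun i _ => ?_) fun i _ => ?_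
          · have : (0 : ℝ) ≤ q - 1 := by linarith
            positivity
          · refine le_trans (le_of_eq ?_) (bernoulli_exp_moment_le hp0 hp1
              (by rw [ht, abs_neg, abs_of_nonneg (by linarith)]; linarith) (hb i))
            rw [hp]
            field_simp
      _ = _ := by simp
  calc _ ≤ Real.exp (-t * -(ε * p * n)) * Real.exp (n * (t ^ 2 * p)) := by gcongr
    _ = _ := by
      rw [← Real.exp_add, ht, hp]
      congr 1
      field_simp
      ring

/-! ### Recurrence at a single scale -/

/-- Every set of more than `2 ε n + 1` points of `{0, …, n - 1}` has a difference `i + 1` such that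
`m = L * (i + 1)` satisfies the Diophantine inequality at `y`. -/
def RecurrentAtScale (a b α ε : ℝ) (L n : ℕ) (y : ℝ) : Prop :=
  ∀ A ⊆ Finset.range n, 2 * ε * n + 1 < A.card →
    ∃ i < n, distNearestInt (α ^ (((L * (i + 1) : ℕ) : ℝ) ^ b) * y) <
      ((L * (i + 1) : ℕ) : ℝ) ^ (-a) ∧ ∃ x ∈ A, x + (i + 1) ∈ A

theorem exists_two_pow_between {x : ℝ} (hx : 1 ≤ x) : ∃ k : ℕ, (2 : ℝ) ^ k ≤ x ∧ x < 2 * 2 ^ k := by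
  obtain ⟨k, hk1, hk2⟩ := exists_nat_pow_near hx one_lt_two
  exact ⟨k, hk1, by rwa [pow_succ'] at hk2⟩

theorem measure_not_recurrentAtScale_le {a b α ε : ℝ} (ha : 0 ≤ a) (hb : 0 ≤ b) (hα : 1 < α)
    (hε0 : 0 < ε) (hε1 : ε ≤ 1) {L n : ℕ} (hL : 0 < L) (hn : 0 < n)
    (hlac : ∀ x : ℕ, 0 < x → x < n → α ^ (((L * x : ℕ) : ℝ) ^ b) * (8 * ((L * n : ℕ) : ℝ) ^ a) ≤
      α ^ (((L * (x + 1) : ℕ) : ℝ) ^ b)) :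
    (volume.restrict (Ico (0 : ℝ) 1)).real {y | ¬ RecurrentAtScale a b α ε L n y} ≤
      (2 * n + 1) * Real.exp (-(ε ^ 2 * n / (16 * ((L * n : ℕ) : ℝ) ^ a))) := by
  classical
  set D : ℝ := ((L * n : ℕ) : ℝ) ^ a with hD
  have hLn : (1 : ℝ) ≤ ((L * n : ℕ) : ℝ) := by exact_mod_cast Nat.mul_pos hL hn
  have hD1 : 1 ≤ D := Real.one_le_rpow hLn ha
  -- The base `q = 2 ^ r` lies in `(2 * D, 4 * D]`: large enough for accuracy `1 / D`, and small
  -- enough that the gap `8 * D` leaves room for the `r` binary digits used by each multiplier.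
  obtain ⟨r, hr1, hr2⟩ := exists_two_pow_between (by linarith : 1 ≤ 4 * D)
  set l : ℕ → ℝ := fun i => α ^ (((L * (i + 1) : ℕ) : ℝ) ^ b) with hl
  have hl1 : ∀ i, 1 ≤ l i := fun i => Real.one_le_rpow hα.le (by positivity)
  have hlmono : Monotone l := by
    intro i j hij
    apply Real.rpow_le_rpow_of_exponent_le hα.le
    apply Real.rpow_le_rpow (by positivity) _ hb
    exact_mod_cast Nat.mul_le_mul_left L (by omega : i + 1 ≤ j + 1)
  choose k hk1 hk2 using fun i => exists_two_pow_between (hl1 i)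
  have hq : 0 < 2 ^ r := by positivity
  have hM : ∀ i, 0 < 2 ^ k i := fun i => by positivity
  have hdvd : ∀ i j, i < j → j < n → 2 ^ k i * 2 ^ r ∣ 2 ^ k j := by
    intro i j hij hj
    rw [← pow_add]
    apply pow_dvd_pow
    have h1 : l i * (8 * D) ≤ l j :=
      (hlac (i + 1) i.succ_pos (by omega)).trans (hlmono (by omega : i + 1 ≤ j))
    have h2 : (2 : ℝ) ^ (k i + r + 1) < 2 ^ (k j + 1) := by
      calc (2 : ℝ) ^ (k i + r + 1) = 2 ^ k i * (2 * 2 ^ r) := by rw [pow_succ, pow_add]; ring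
        _ ≤ l i * (8 * D) := mul_le_mul (hk1 i) (by linarith) (by positivity)
          (by linarith [hl1 i])
        _ ≤ l j := h1
        _ < 2 * 2 ^ k j := hk2 j
        _ = _ := (pow_succ' _ _).symm
    have := (pow_lt_pow_iff_right₀ (one_lt_two : (1 : ℝ) < 2)).1 h2
    omega
  choose c hc hc' using fun i => exists_digit_selection (M := 2 ^ k i) (q := 2 ^ r)
    (l := l i) (δ := 1 / D) (hM i) hq (by exact_mod_cast hk1 i) (by exact_mod_cast hk2 i)
    (by push_cast; rw [div_div_eq_mul_div]; linarith) (by positivity)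
  set bad : ℕ → Set ℝ := fun j => {y | ∑ i ∈ Finset.range n,
        ((if y ∈ digitEvent (2 ^ k i) (2 ^ r) (c i) then 1 else 0) - (1 / (2 ^ r : ℕ) : ℝ)) *
        Real.cos (2 * Real.pi * j * (i + 1 : ℕ) / (2 * n + 1 : ℕ)) ≤
        -(ε * (1 / (2 ^ r : ℕ)) * n)} with hbad
  have hbadle : ∀ j, (volume.restrict (Ico (0 : ℝ) 1)).real (bad j) ≤
      Real.exp (-(ε ^ 2 * n / (16 * D))) := by
    intro j
    refine (measure_digitEvent_sum_le hq hM hc hdvd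
      (fun i => Real.abs_cos_le_one _) hε0.le hε1).trans ?_
    apply Real.exp_le_exp.2
    apply neg_le_neg
    apply div_le_div_of_nonneg_left (by positivity) (by positivity)
    push_cast
    linarith
  have hsub : {y | ¬ RecurrentAtScale a b α ε L n y} ∩ Ico (0 : ℝ) 1 ⊆
      ⋃ j ∈ Finset.range (2 * n + 1), bad j := by
    rintro y ⟨hy, hy0, hy1⟩
    by_contra hnot
    simp only [mem_iUnion, not_exists, Finset.mem_range, hbad, mem_ofPred_eq, not_le] at hnot
    refine hy fun A hA hcard => ?_
    obtain ⟨i, hi, hE, hx⟩ := exists_difference_of_cosine_sums hA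
      (p := 1 / (2 ^ r : ℕ)) (by positivity) hcard hε0.le
      (fun i => y ∈ digitEvent (2 ^ k i) (2 ^ r) (c i)) (fun j hj => (hnot j hj).le)
    refine ⟨i, hi, (hc' i y hy0 hE).trans_le ?_, hx⟩
    rw [Real.rpow_neg (by positivity), ← one_div]
    apply one_div_le_one_div_of_le
    · apply Real.rpow_pos_of_pos
      exact_mod_cast Nat.mul_pos hL i.succ_pos
    · apply Real.rpow_le_rpow (by positivity) _ ha
      exact_mod_cast Nat.mul_le_mul_left L (by omega : i + 1 ≤ n)
  calc (volume.restrict (Ico (0 : ℝ) 1)).real {y | ¬ RecurrentAtScale a b α ε L n y}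
      = (volume.restrict (Ico (0 : ℝ) 1)).real
          ({y | ¬ RecurrentAtScale a b α ε L n y} ∩ Ico (0 : ℝ) 1) := by
        simp only [measureReal_def, Measure.restrict_apply' measurableSet_Ico, inter_assoc,
          inter_self]
    _ ≤ (volume.restrict (Ico (0 : ℝ) 1)).real (⋃ j ∈ Finset.range (2 * n + 1), bad j) :=
        measureReal_mono hsub (measure_ne_top _ _)
    _ ≤ ∑ j ∈ Finset.range (2 * n + 1), (volume.restrict (Ico (0 : ℝ) 1)).real (bad j) :=
        measureReal_biUnion_finset_le _ _
    _ ≤ ∑ j ∈ Finset.range (2 * n + 1), Real.exp (-(ε ^ 2 * n / (16 * D))) :=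
        Finset.sum_le_sum fun j _ => hbadle j
    _ = _ := by simp

/-! ### Choice of lacunary scales -/

theorem rpow_add_one_sub_rpow_ge {b x : ℝ} (hb : 0 < b) (hx : 1 ≤ x) :
    b / 2 * x ^ (b - 1) ≤ (x + 1) ^ b - x ^ b := by
  have hx0 : 0 < x := by linarith
  have h1 : (x + 1) ^ b = x ^ b * (1 + 1 / x) ^ b := by
    rw [← Real.mul_rpow hx0.le (by positivity)]
    congr 1
    field_simp
  have h2 : 1 + b * Real.log (1 + 1 / x) ≤ (1 + 1 / x) ^ b := by
    rw [Real.rpow_def_of_pos (by positivity)]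
    have := Real.add_one_le_exp (Real.log (1 + 1 / x) * b)
    linarith
  have h3 : 1 / (2 * x) ≤ Real.log (1 + 1 / x) := by
    have := Real.one_sub_inv_le_log_of_pos (by positivity : 0 < 1 + 1 / x)
    refine le_trans ?_ this
    have e : 1 - (1 + 1 / x)⁻¹ = 1 / (x + 1) := by field_simp; ring
    rw [e]
    apply one_div_le_one_div_of_le <;> linarith
  have hxb : 0 < x ^ b := Real.rpow_pos_of_pos hx0 b
  rw [Real.rpow_sub_one hx0.ne']
  calc b / 2 * (x ^ b / x) = x ^ b * (b * (1 / (2 * x))) := by field_simp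
    _ ≤ x ^ b * (b * Real.log (1 + 1 / x)) := by gcongr
    _ ≤ x ^ b * ((1 + 1 / x) ^ b - 1) := by gcongr; linarith
    _ = _ := by rw [h1]; ring

theorem exists_lacunary_scales {a b α : ℝ} (ha : 0 < a) (ha1 : a < 1) (hab : a < b)
    (hα : 1 < α) :
    ∃ (L : ℕ → ℕ) (σ : ℝ), σ < 1 ∧ Tendsto L atTop atTop ∧ ∀ᶠ n : ℕ in atTop,
      ((L n * n : ℕ) : ℝ) ^ a ≤ 2 * (n : ℝ) ^ σ ∧
      ∀ x : ℕ, 0 < x → x < n →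
        α ^ (((L n * x : ℕ) : ℝ) ^ b) * (8 * ((L n * n : ℕ) : ℝ) ^ a) ≤
          α ^ (((L n * (x + 1) : ℕ) : ℝ) ^ b) := by
  have hb : 0 < b := ha.trans hab
  set g : ℝ := max 0 (1 - b) with hg
  have hg0 : 0 ≤ g := le_max_left _ _
  have hg1 : 1 - b ≤ g := le_max_right _ _
  -- The lower bound makes the exponent gaps grow like a positive power of `n`; the upper bound
  -- keeps `(L * n) ^ a` below a power `n ^ σ` with `σ < 1`. The interval is nonempty because `a <
  -- 1` and `a < b`.
  obtain ⟨κ, hκ1, hκ2⟩ : ∃ κ, g / b < κ ∧ κ < 1 / a - 1 := by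
    apply exists_between
    rw [hg, div_lt_iff₀ hb, max_lt_iff]
    have h1 : 1 < 1 / a := by rw [lt_div_iff₀ ha]; linarith
    refine ⟨by nlinarith, ?_⟩
    have h2 : 1 < 1 / a * b := by rw [one_div, inv_mul_eq_div, lt_div_iff₀ ha]; linarith
    linarith
  have hκ0 : 0 < κ := lt_of_le_of_lt (by positivity) hκ1
  have hη : 0 < κ * b - g := by rw [div_lt_iff₀ hb] at hκ1; linarith
  set η := κ * b - g with hηdef
  have hσ : (1 + κ) * a < 1 := by
    have : 1 + κ < 1 / a := by linarith
    rwa [lt_div_iff₀ ha] at this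
  have hcast : Tendsto (fun n : ℕ => (n : ℝ)) atTop atTop := tendsto_natCast_atTop_atTop
  refine ⟨fun n => ⌈(n : ℝ) ^ κ⌉₊, (1 + κ) * a, hσ,
    tendsto_nat_ceil_atTop.comp ((tendsto_rpow_atTop hκ0).comp hcast), ?_⟩
  have hgrow : ∀ᶠ n : ℕ in atTop,
      16 * (n : ℝ) ≤ α ^ (b / 2 * (n : ℝ) ^ η) := by
    have hlogα : 0 < Real.log α := Real.log_pos hα
    have h1 := (isLittleO_log_rpow_atTop hη).comp_tendsto hcast
    have h2 := h1.bound (show 0 < Real.log α * b / 4 by positivity)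
    have h3 := ((tendsto_rpow_atTop hη).comp hcast).eventually_ge_atTop
      (Real.log 16 / (Real.log α * b / 4))
    filter_upwards [h2, h3, eventually_gt_atTop 0] with n h2 h3 hn
    have hn' : (0 : ℝ) < n := by exact_mod_cast hn
    simp only [Function.comp_apply, Real.norm_eq_abs] at h2 h3
    rw [abs_of_nonneg (by positivity : (0 : ℝ) ≤ (n : ℝ) ^ η)] at h2
    rw [div_le_iff₀ (by positivity)] at h3
    have h4 := (le_abs_self _).trans h2
    rw [← Real.exp_log (by positivity : (0 : ℝ) < 16 * n), Real.rpow_def_of_pos (by linarith),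
      Real.exp_le_exp, Real.log_mul (by norm_num) hn'.ne']
    linarith
  filter_upwards [hgrow, eventually_gt_atTop 0] with n hgrow hn
  have hn1 : (1 : ℝ) ≤ n := by exact_mod_cast hn
  have hn0 : (0 : ℝ) < n := by linarith
  set L : ℕ := ⌈(n : ℝ) ^ κ⌉₊
  have hnκ : 1 ≤ (n : ℝ) ^ κ := Real.one_le_rpow hn1 hκ0.le
  have hL1 : (n : ℝ) ^ κ ≤ L := Nat.le_ceil _
  have hL2 : (L : ℝ) ≤ 2 * (n : ℝ) ^ κ := by
    have := Nat.ceil_lt_add_one (by positivity : 0 ≤ (n : ℝ) ^ κ)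
    linarith
  have hLn : ((L * n : ℕ) : ℝ) ^ a ≤ 2 * (n : ℝ) ^ ((1 + κ) * a) := by
    calc ((L * n : ℕ) : ℝ) ^ a ≤ (2 * (n : ℝ) ^ (1 + κ)) ^ a := by
          apply Real.rpow_le_rpow (by positivity) _ ha.le
          push_cast
          rw [Real.rpow_add hn0, Real.rpow_one]
          nlinarith
      _ = 2 ^ a * (n : ℝ) ^ ((1 + κ) * a) := by
          rw [Real.mul_rpow (by norm_num) (by positivity), ← Real.rpow_mul hn0.le]
      _ ≤ 2 * (n : ℝ) ^ ((1 + κ) * a) := by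
          gcongr
          calc (2 : ℝ) ^ a ≤ 2 ^ (1 : ℝ) :=
                Real.rpow_le_rpow_of_exponent_le (by norm_num) ha1.le
            _ = 2 := Real.rpow_one 2
  refine ⟨hLn, fun x hx0 hxn => ?_⟩
  have hx1 : (1 : ℝ) ≤ x := by exact_mod_cast hx0
  have hxn' : (x : ℝ) ≤ n := by exact_mod_cast hxn.le
  have hdiff : b / 2 * (n : ℝ) ^ η ≤
      ((L * (x + 1) : ℕ) : ℝ) ^ b - ((L * x : ℕ) : ℝ) ^ b := by
    push_cast
    rw [Real.mul_rpow (by positivity) (by positivity), Real.mul_rpow (by positivity) (by positivity),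
      ← mul_sub]
    have h1 := rpow_add_one_sub_rpow_ge hb hx1
    have h2 : (n : ℝ) ^ (-g) ≤ (x : ℝ) ^ (b - 1) :=
      calc (n : ℝ) ^ (-g) ≤ (x : ℝ) ^ (-g) :=
            Real.rpow_le_rpow_of_nonpos (by linarith) hxn' (by linarith)
        _ ≤ (x : ℝ) ^ (b - 1) := Real.rpow_le_rpow_of_exponent_le hx1 (by linarith)
    have h3 : (n : ℝ) ^ (κ * b) ≤ (L : ℝ) ^ b := by
      rw [Real.rpow_mul hn0.le]
      exact Real.rpow_le_rpow (by positivity) hL1 hb.le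
    calc b / 2 * (n : ℝ) ^ η = (n : ℝ) ^ (κ * b) * (b / 2 * (n : ℝ) ^ (-g)) := by
          rw [hηdef, sub_eq_add_neg, Real.rpow_add hn0]; ring
      _ ≤ (L : ℝ) ^ b * (b / 2 * (x : ℝ) ^ (b - 1)) := by gcongr
      _ ≤ _ := by gcongr
  have h8 : 8 * ((L * n : ℕ) : ℝ) ^ a ≤ α ^ (b / 2 * (n : ℝ) ^ η) := by
    have : (n : ℝ) ^ ((1 + κ) * a) ≤ (n : ℝ) ^ (1 : ℝ) :=
      Real.rpow_le_rpow_of_exponent_le hn1 hσ.le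
    rw [Real.rpow_one] at this
    linarith
  have hα0 : 0 < α := by linarith
  calc _ ≤ α ^ (((L * x : ℕ) : ℝ) ^ b) * α ^ (b / 2 * (n : ℝ) ^ η) := by gcongr
    _ = α ^ (((L * x : ℕ) : ℝ) ^ b + b / 2 * (n : ℝ) ^ η) := (Real.rpow_add hα0 _ _).symm
    _ ≤ _ := Real.rpow_le_rpow_of_exponent_le hα.le (by linarith)

/-! ### Passage to almost every point -/

theorem tendsto_linear_mul_exp_neg_rpow {s C : ℝ} (hs : 0 < s) (hC : 0 < C) :
    Tendsto (fun n : ℕ => (2 * (n : ℝ) + 1) * Real.exp (-(C * (n : ℝ) ^ s))) atTop (𝓝 0) := by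
  have hcast : Tendsto (fun n : ℕ => (n : ℝ)) atTop atTop := tendsto_natCast_atTop_atTop
  have h1 : Tendsto (fun u : ℝ => u ^ (1 / s) * Real.exp (-C * u)) atTop (𝓝 0) :=
    tendsto_rpow_mul_exp_neg_mul_atTop_nhds_zero _ _ hC
  have h2 := h1.comp ((tendsto_rpow_atTop hs).comp hcast)
  have h3 : Tendsto (fun n : ℕ => 3 * ((n : ℝ) * Real.exp (-(C * (n : ℝ) ^ s)))) atTop (𝓝 0) := by
    rw [← mul_zero (3 : ℝ)]
    refine (h2.const_mul 3).congr fun n => ?_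
    simp only [Function.comp_apply]
    rw [← Real.rpow_mul (Nat.cast_nonneg n), mul_one_div_cancel hs.ne', Real.rpow_one, neg_mul]
  refine squeeze_zero' (Eventually.of_forall fun n => by positivity) ?_ h3
  filter_upwards [eventually_gt_atTop 0] with n hn
  have hn1 : (1 : ℝ) ≤ n := by exact_mod_cast hn
  rw [← mul_assoc]
  gcongr
  linarith

theorem ae_frequently_recurrentAtScale {a b α ε σ : ℝ} {L : ℕ → ℕ} (ha : 0 ≤ a) (hb : 0 ≤ b)
    (hα : 1 < α) (hε0 : 0 < ε) (hε1 : ε ≤ 1) (hσ : σ < 1) (hL : Tendsto L atTop atTop)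
    (hscale : ∀ᶠ n : ℕ in atTop, ((L n * n : ℕ) : ℝ) ^ a ≤ 2 * (n : ℝ) ^ σ ∧
      ∀ x : ℕ, 0 < x → x < n →
        α ^ (((L n * x : ℕ) : ℝ) ^ b) * (8 * ((L n * n : ℕ) : ℝ) ^ a) ≤
          α ^ (((L n * (x + 1) : ℕ) : ℝ) ^ b)) :
    ∀ᵐ y ∂(volume.restrict (Ico (0 : ℝ) 1)),
      ∃ᶠ n : ℕ in atTop, RecurrentAtScale a b α ε (L n) n y := by
  set μ := volume.restrict (Ico (0 : ℝ) 1)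
  have hle : ∀ᶠ n : ℕ in atTop, μ.real {y | ¬ RecurrentAtScale a b α ε (L n) n y} ≤
      (2 * (n : ℝ) + 1) * Real.exp (-(ε ^ 2 / 32 * (n : ℝ) ^ (1 - σ))) := by
    filter_upwards [hscale, hL.eventually_gt_atTop 0, eventually_gt_atTop 0] with n hn hLn hn0
    refine (measure_not_recurrentAtScale_le ha hb hα hε0 hε1 hLn hn0 hn.2).trans ?_
    have hn0' : (0 : ℝ) < n := by exact_mod_cast hn0
    have hpos : 0 < ((L n * n : ℕ) : ℝ) ^ a := by
      apply Real.rpow_pos_of_pos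
      exact_mod_cast Nat.mul_pos hLn hn0
    gcongr
    rw [Real.rpow_sub hn0', Real.rpow_one, le_div_iff₀ (by positivity)]
    calc ε ^ 2 / 32 * (n / (n : ℝ) ^ σ) * (16 * ((L n * n : ℕ) : ℝ) ^ a)
        ≤ ε ^ 2 / 32 * (n / (n : ℝ) ^ σ) * (16 * (2 * (n : ℝ) ^ σ)) := by gcongr; exact hn.1
      _ = ε ^ 2 * n := by field_simp; ring
  have htend : Tendsto (fun n : ℕ => μ.real {y | ¬ RecurrentAtScale a b α ε (L n) n y}) atTop
      (𝓝 0) :=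
    squeeze_zero' (Eventually.of_forall fun n => measureReal_nonneg) hle
      (tendsto_linear_mul_exp_neg_rpow (by linarith) (by positivity))
  have hnull : ∀ n₀ : ℕ, ∀ᵐ y ∂μ, ∃ n ≥ n₀, RecurrentAtScale a b α ε (L n) n y := by
    intro n₀
    rw [ae_iff, ← measureReal_eq_zero_iff]
    -- Failure at every `n ≥ n₀` lies inside each single failure set, so measures tending to zero
    -- suffice; no summability is needed.
    refine le_antisymm (ge_of_tendsto htend ?_) measureReal_nonneg
    filter_upwards [eventually_ge_atTop n₀] with n hn
    refine measureReal_mono fun y hy => ?_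
    simp only [mem_ofPred_eq, not_exists, not_and] at hy ⊢
    exact hy n hn
  filter_upwards [ae_all_iff.2 hnull] with y hy
  rw [frequently_atTop]
  exact hy

theorem mainTheorem4 (a b α : ℝ) (ha : 0 < a) (ha1 : a < 1) (hb : 0 < b) (hab : 2 * a < b)
    (hα : 1 < α) :
    ∀ᵐ y ∂(MeasureTheory.volume.restrict (Set.Icc (0 : ℝ) 1)),
      ∀ A : Set ℕ, 0 < upperDensity A →
        {m : ℕ | 0 < m ∧ distNearestInt (α ^ ((m : ℝ) ^ b) * y) < (m : ℝ) ^ (-a) ∧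
          {n : ℕ | 0 < n ∧ n ∈ A ∧ n + m ∈ A}.Infinite}.Infinite := by
  classical
  obtain ⟨L, σ, hσ, hL, hscale⟩ := exists_lacunary_scales ha ha1 (by linarith : a < b) hα
  rw [← restrict_Ico_eq_restrict_Icc]
  have hall : ∀ᵐ y ∂(volume.restrict (Ico (0 : ℝ) 1)), ∀ e : ℕ,
      ∃ᶠ n : ℕ in atTop, RecurrentAtScale a b α (1 / ((e : ℝ) + 1)) (L n) n y :=
    ae_all_iff.2 fun e => ae_frequently_recurrentAtScale ha.le hb.le hα (by positivity)
      (by rw [div_le_one (by positivity)]; linarith [(Nat.cast_nonneg e : (0 : ℝ) ≤ e)])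
      hσ hL hscale
  filter_upwards [hall] with y hy A hA
  obtain ⟨δ, hδ, hprog⟩ := exists_progression_of_upperDensity_pos hA
  -- With `ε = 1 / (e + 1) < δ / 4` and `n > 2 / δ`, the threshold `2 * ε * n + 1` falls below `δ *
  -- n`.
  obtain ⟨e, he⟩ := exists_nat_one_div_lt (show 0 < δ / 4 by positivity)
  rw [Set.infinite_iff_exists_gt]
  intro m₀
  obtain ⟨n, hrec, hn0, hnδ, hLn⟩ := ((hy e).and_eventually ((eventually_gt_atTop 0).and
    ((tendsto_natCast_atTop_atTop.eventually_gt_atTop (2 / δ)).and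
      (hL.eventually_gt_atTop m₀)))).exists
  have hn0' : (0 : ℝ) < n := by exact_mod_cast hn0
  rw [div_lt_iff₀ hδ] at hnδ
  have hpt : ∀ B : ℕ, ∃ i : Fin n, ∃ z > B,
      distNearestInt (α ^ (((L n * (i + 1) : ℕ) : ℝ) ^ b) * y) <
        ((L n * (i + 1) : ℕ) : ℝ) ^ (-a) ∧ z ∈ A ∧ z + L n * (i + 1) ∈ A := by
    intro B
    obtain ⟨n₀, hn₀, hcard⟩ := hprog n (L n) hn0 B
    obtain ⟨i, hi, hdist, x, hx, hx'⟩ := hrec _ (Finset.filter_subset _ _)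
      (lt_of_lt_of_le (by nlinarith) hcard)
    refine ⟨⟨i, hi⟩, n₀ + L n * x, by omega, hdist, (Finset.mem_filter.1 hx).2, ?_⟩
    have := (Finset.mem_filter.1 hx').2
    rwa [mul_add, ← add_assoc] at this
  choose i z hz hdist hzA hzA' using hpt
  -- There are only `n` indices but infinitely many bounds `B`, so one index serves arbitrarily
  -- large `z`.
  obtain ⟨i₀, hi₀⟩ := Finite.exists_infinite_fiber i
  rw [Set.infinite_coe_iff] at hi₀
  obtain ⟨B₀, hB₀⟩ := hi₀.nonempty
  have hB₀' : i B₀ = i₀ := hB₀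
  refine ⟨L n * (i₀ + 1), ⟨Nat.mul_pos (by omega) (Nat.succ_pos _), ?_, ?_⟩, ?_⟩
  · rw [← hB₀']; exact hdist B₀
  · rw [Set.infinite_iff_exists_gt]
    intro N
    obtain ⟨B, hB, hNB⟩ := hi₀.exists_gt N
    have hB' : i B = i₀ := hB
    refine ⟨z B, ⟨by have := hz B; omega, hzA B, ?_⟩, by have := hz B; omega⟩
    rw [← hB']; exact hzA' B
  · exact hLn.trans_le (Nat.le_mul_of_pos_right _ (Nat.succ_pos _))
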